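/- For $i\in\{1,\dots,5\}$ let $S_i:\mathbb{R}\to\mathbb{R}$, $S_i(x)=\frac{x}{5}+\frac{i-1}{5}$. Let $M$ (the $\{1,3,5\}$-set) and $M'$ (the $\{1,4,5\}$-set) be the attractors of the iterated function systems $\{S_1,S_3,S_5\}$ and $\{S_1,S_4,S_5\}$; that is, $M$ and $M'$ are the unique nonempty compact subsets of $\mathbb{R}$ with $$M=S_1(M)\cup S_3(M)\cup S_5(M),\qquad M'=S_1(M')\cup S_4(M')\cup S_5(M').$$ Then $M$ and $M'$ are Lipschitz equivalent: there exist a bijection $f:M\to M'$ and constants $c,c'>0$ such that $$c\,|x-y|\le |f(x)-f(y)|\le c'\,|x-y|\qquad\text{for all }x,y\in M.$$ -/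

import Mathlib

open TopologicalSpace

/-- Two subsets `E`, `F` of metric spaces are Lipschitz equivalent if there is a bijection
`f : E → F` and positive constants `c`, `c'` with
`c * |x - y| ≤ |f x - f y| ≤ c' * |x - y|` for all `x y ∈ E`. -/
def LipschitzEquivalent {X Y : Type*} [MetricSpace X] [MetricSpace Y]
    (E : Set X) (F : Set Y) : Prop :=
  ∃ f : E → F, Function.Bijective f ∧ ∃ c c' : ℝ, 0 < c ∧ 0 < c' ∧
    ∀ x y : E, c * dist x y ≤ dist (f x) (f y) ∧ dist (f x) (f y) ≤ c' * dist x y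

/-- `K` is the attractor of the iterated function system `{F i : i ∈ I}`: a nonempty compact set
which is the union of its images under the maps of the system. -/
def IsAttractor {X ι : Type*} [MetricSpace X] (F : ι → X → X) (I : Finset ι) (K : Set X) : Prop :=
  K.Nonempty ∧ IsCompact K ∧ ⋃ i ∈ I, F i '' K = K

/-- A finite nonempty system of contractions of a complete space has exactly one attractor. -/
theorem existsUnique_isAttractor {X ι : Type*} [MetricSpace X] [CompleteSpace X] [Nonempty X]
    {F : ι → X → X} {I : Finset ι} (hI : I.Nonempty) {r : NNReal} (hr : r < 1)
    (hF : ∀ i ∈ I, LipschitzWith r (F i)) : ∃! K : Set X, IsAttractor F I K := by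
  let Φ : NonemptyCompacts X → NonemptyCompacts X := fun K =>
    ⟨⟨⋃ i ∈ I, F i '' K, I.isCompact_biUnion fun i hi =>
      K.isCompact.image (hF i hi).continuous⟩, by
      obtain ⟨i, hi⟩ := hI
      obtain ⟨x, hx⟩ := K.nonempty
      exact ⟨F i x, Set.mem_biUnion hi ⟨x, hx, rfl⟩⟩⟩
  have hΦc (K : NonemptyCompacts X) : (Φ K : Set X) = ⋃ i ∈ I, F i '' K := rfl
  have key (A B : NonemptyCompacts X) : ∀ x ∈ (Φ A : Set X), ∃ y ∈ (Φ B : Set X),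
      dist x y ≤ r * dist A B := by
    intro x hx
    simp only [hΦc, Set.mem_iUnion] at hx
    obtain ⟨i, hi, a, ha, rfl⟩ := hx
    obtain ⟨b, hb, hab⟩ := B.isCompact.exists_infDist_eq_dist B.nonempty a
    refine ⟨F i b, Set.mem_biUnion hi ⟨b, hb, rfl⟩, ((hF i hi).dist_le_mul a b).trans ?_⟩
    refine mul_le_mul_of_nonneg_left ?_ r.2
    rw [← hab, Metric.NonemptyCompacts.dist_eq]
    exact Metric.infDist_le_hausdorffDist_of_mem ha
      (Metric.hausdorffEDist_ne_top_of_nonempty_of_bounded A.nonempty B.nonempty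
        A.isCompact.isBounded B.isCompact.isBounded)
  have hΦ : ContractingWith r Φ := by
    refine ⟨hr, LipschitzWith.of_dist_le_mul fun A B => ?_⟩
    rw [Metric.NonemptyCompacts.dist_eq]
    refine Metric.hausdorffDist_le_of_mem_dist (by positivity) (key A B) ?_
    simpa only [dist_comm A B] using key B A
  have : Nonempty (NonemptyCompacts X) := ⟨{Classical.arbitrary X}⟩
  refine ⟨(ContractingWith.fixedPoint Φ hΦ : NonemptyCompacts X), ⟨NonemptyCompacts.nonempty _,
    NonemptyCompacts.isCompact _, ?_⟩, ?_⟩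
  · exact congrArg (fun K : NonemptyCompacts X => (K : Set X)) hΦ.fixedPoint_isFixedPt
  · rintro K ⟨hne, hc, hK⟩
    have h : (⟨⟨K, hc⟩, hne⟩ : NonemptyCompacts X) = ContractingWith.fixedPoint Φ hΦ :=
      hΦ.fixedPoint_unique (SetLike.coe_injective hK)
    exact congrArg (fun K : NonemptyCompacts X => (K : Set X)) h

/-- The contraction `S_i(x) = x / 5 + (i - 1) / 5` of the real line; for `i = 1, …, 5` it maps
`[0, 1]` into itself. -/
noncomputable def fifthMap (i : ℕ) (x : ℝ) : ℝ := x / 5 + ((i : ℝ) - 1) / 5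

theorem lipschitzWith_fifthMap (i : ℕ) : LipschitzWith (1 / 5) (fifthMap i) := by
  refine LipschitzWith.of_dist_le_mul fun x y => le_of_eq ?_
  have h : fifthMap i x - fifthMap i y = 1 / 5 * (x - y) := by unfold fifthMap; ring
  rw [Real.dist_eq, Real.dist_eq, h, abs_mul]
  norm_num

/-- Each of the systems `{S_i : i ∈ I}`, `I` nonempty, has exactly one attractor. -/
theorem existsUnique_isAttractor_fifthMap {I : Finset ℕ} (hI : I.Nonempty) :
    ∃! K : Set ℝ, IsAttractor fifthMap I K :=
  existsUnique_isAttractor hI (by rw [one_div]; exact inv_lt_one_of_one_lt₀ (by norm_num))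
    fun i _ => lipschitzWith_fifthMap i

/-! ### Lipschitz equivalences from approximate correspondences -/

open Filter Topology

/-! Write `A s` for the union of `s + 1` translates of the attractor, with step 1 for the touching
pieces of `M'` and step 2 for the disjoint pieces of `M`, where `s = 0, 1, 2`. Cutting `5 * A s`
into such unions gives, in both cases, one copy of `A 0`, one of `A 1` and `s` of `A 2`. So both
families obey graph-directed systems on the same graph, with ratio 1/5 and separated pieces; only
the translations and the order of the pieces on the line differ.

Matching points with the same edge itinerary then distorts distances boundedly: in either family,
the distance of two points is comparable to `(1/5)^n`, with `n` the length of their common itinerary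
(`SameItinerary.dist_le`). Only finite itineraries are used; `lipschitzEquivalent_of_approx` passes
to the limit. Vertex 0 gives the theorem. -/

/-- A sequence of relations between two compact sets which are total on both sides and
comparable with the distances up to errors tending to zero yields a Lipschitz equivalence. -/
theorem lipschitzEquivalent_of_approx {X Y : Type*} [MetricSpace X] [MetricSpace Y]
    {A : Set X} {B : Set Y} (hA : IsComplete A) (hB : IsComplete B) {R : ℕ → X → Y → Prop}
    (hmono : ∀ n x y, R (n + 1) x y → R n x y)
    (hRA : ∀ n x y, R n x y → x ∈ A) (hRB : ∀ n x y, R n x y → y ∈ B)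
    (hl : ∀ n, ∀ x ∈ A, ∃ y, R n x y) (hr : ∀ n, ∀ y ∈ B, ∃ x, R n x y)
    {C : ℝ} (hC : 0 < C) {ε : ℕ → ℝ} (hε : Tendsto ε atTop (𝓝 0))
    (hxy : ∀ n x y x' y', R n x y → R n x' y' → dist y y' ≤ C * max (dist x x') (ε n))
    (hyx : ∀ n x y x' y', R n x y → R n x' y' → dist x x' ≤ C * max (dist y y') (ε n)) :
    LipschitzEquivalent A B := by
  have hanti : ∀ x y, Antitone fun n => R n x y := fun x y =>
    antitone_nat_of_succ_le fun n => hmono n x y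
  have hmax : Tendsto (fun n => C * max 0 (ε n)) atTop (𝓝 0) := by
    simpa using ((tendsto_const_nhds (x := (0 : ℝ))).max hε).const_mul C
  have limB : ∀ x ∈ A, ∃ y ∈ B, ∃ u : ℕ → Y, (∀ n, R n x (u n)) ∧ Tendsto u atTop (𝓝 y) := by
    intro x hx
    choose u hu using fun n => hl n x hx
    -- From stage `N` on, all `u n` are `N`-related to the same `x`, so they lie within `C * max 0
    -- (ε N)` of each other.
    have hc : CauchySeq u := cauchySeq_of_le_tendsto_0 _ (fun n m N hn hm => by
      simpa using hxy N x (u n) x (u m) (hanti _ _ hn (hu n)) (hanti _ _ hm (hu m))) hmax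
    obtain ⟨y, hy, h⟩ := cauchySeq_tendsto_of_isComplete hB (fun n => hRB _ _ _ (hu n)) hc
    exact ⟨y, hy, u, hu, h⟩
  have limA : ∀ y ∈ B, ∃ x ∈ A, ∃ u : ℕ → X, (∀ n, R n (u n) y) ∧ Tendsto u atTop (𝓝 x) := by
    intro y hy
    choose u hu using fun n => hr n y hy
    have hc : CauchySeq u := cauchySeq_of_le_tendsto_0 _ (fun n m N hn hm => by
      simpa using hyx N (u n) y (u m) y (hanti _ _ hn (hu n)) (hanti _ _ hm (hu m))) hmax
    obtain ⟨x, hx, h⟩ := cauchySeq_tendsto_of_isComplete hA (fun n => hRA _ _ _ (hu n)) hc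
    exact ⟨x, hx, u, hu, h⟩
  choose f hfB u hu hlim using limB
  have up : ∀ x (hx : x ∈ A) x' (hx' : x' ∈ A), dist (f x hx) (f x' hx') ≤ C * dist x x' := by
    intro x hx x' hx'
    have h1 := (tendsto_const_nhds (x := dist x x')).max hε
    rw [max_eq_left dist_nonneg] at h1
    exact le_of_tendsto_of_tendsto' ((hlim x hx).dist (hlim x' hx')) (h1.const_mul C)
      fun n => hxy n _ _ _ _ (hu x hx n) (hu x' hx' n)
  have low : ∀ x (hx : x ∈ A) x' (hx' : x' ∈ A), dist x x' ≤ C * dist (f x hx) (f x' hx') := by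
    intro x hx x' hx'
    have h1 := ((hlim x hx).dist (hlim x' hx')).max hε
    rw [max_eq_left dist_nonneg] at h1
    exact ge_of_tendsto' (h1.const_mul C) fun n => hyx n _ _ _ _ (hu x hx n) (hu x' hx' n)
  refine ⟨fun x => ⟨f x x.2, hfB x x.2⟩, ⟨?_, ?_⟩, C⁻¹, C, inv_pos.2 hC, hC, ?_⟩
  · intro x x' h
    have h' : f x x.2 = f x' x'.2 := congrArg Subtype.val h
    have := low x x.2 x' x'.2
    rw [h', dist_self, mul_zero] at this
    exact Subtype.ext (dist_le_zero.1 this)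
  · rintro ⟨y, hy⟩
    obtain ⟨x, hx, v, hv, hvx⟩ := limA y hy
    refine ⟨⟨x, hx⟩, Subtype.ext (dist_le_zero.1 ?_)⟩
    -- Compare the related pairs `(x, u n)` and `(v n, y)`: since `v n` tends to `x`, `u n` tends to
    -- `y`.
    have h1 := ((tendsto_const_nhds (x := x)).dist hvx).max hε
    rw [dist_self, max_self] at h1
    simpa using le_of_tendsto_of_tendsto' ((hlim x hx).dist (tendsto_const_nhds (x := y)))
      (h1.const_mul C) fun n => hxy n _ _ _ _ (hu x hx n) (hv n)
  · intro x y
    refine ⟨?_, up x x.2 y y.2⟩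
    rw [inv_mul_le_iff₀ hC]
    exact low x x.2 y y.2

/-! ### Graph-directed systems on a common graph -/

/-- The sets `A s` solve the graph-directed system `A s = ⋃ j ∈ E s, (A (t s j) + a s j) / 5` on
the graph with edges `j : s ⟶ t s j` for `j ∈ E s`, and the union is separated. -/
structure IsSeparatedSystem {σ ι : Type*} (E : σ → Set ι) (t : σ → ι → σ) (a : σ → ι → ℝ)
    (A : σ → Set ℝ) : Prop where
  nonempty : ∀ s, (A s).Nonempty
  isCompact : ∀ s, IsCompact (A s)
  subset_Icc : ∀ s, A s ⊆ Set.Icc 0 5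
  mem_iff : ∀ s x, x ∈ A s ↔ ∃ j ∈ E s, 5 * x - a s j ∈ A (t s j)
  separated : ∀ s, ∀ j ∈ E s, ∀ k ∈ E s, j ≠ k → ∀ x y : ℝ,
    x - a s j ∈ A (t s j) → y - a s k ∈ A (t s k) → 1 ≤ |x - y|

/-- Points of `A s` and `B s` are `n`-related if they have itineraries through the two
graph-directed systems whose first `n` edges agree. -/
def SameItinerary {σ ι : Type*} (E : σ → Set ι) (t : σ → ι → σ) (a b : σ → ι → ℝ)
    (A B : σ → Set ℝ) : ℕ → σ → ℝ → ℝ → Prop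
  | 0, s, x, y => x ∈ A s ∧ y ∈ B s
  | n + 1, s, x, y => ∃ j ∈ E s,
      SameItinerary E t a b A B n (t s j) (5 * x - a s j) (5 * y - b s j)

namespace SameItinerary

variable {σ ι : Type*} {E : σ → Set ι} {t : σ → ι → σ} {a b : σ → ι → ℝ} {A B : σ → Set ℝ}

theorem swap {n : ℕ} {s : σ} {x y : ℝ} (h : SameItinerary E t a b A B n s x y) :
    SameItinerary E t b a B A n s y x := by
  induction n generalizing s x y with
  | zero => exact ⟨h.2, h.1⟩
  | succ n ih =>
    obtain ⟨j, hj, h⟩ := h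
    exact ⟨j, hj, ih h⟩

theorem left_mem (hA : IsSeparatedSystem E t a A) {n : ℕ} {s : σ} {x y : ℝ}
    (h : SameItinerary E t a b A B n s x y) : x ∈ A s := by
  induction n generalizing s x y with
  | zero => exact h.1
  | succ n ih =>
    obtain ⟨j, hj, h⟩ := h
    exact (hA.mem_iff s x).2 ⟨j, hj, ih h⟩

theorem of_succ (hA : IsSeparatedSystem E t a A) (hB : IsSeparatedSystem E t b B) {n : ℕ} {s : σ}
    {x y : ℝ} (h : SameItinerary E t a b A B (n + 1) s x y) :
    SameItinerary E t a b A B n s x y := by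
  induction n generalizing s x y with
  | zero => exact ⟨h.left_mem hA, h.swap.left_mem hB⟩
  | succ n ih =>
    obtain ⟨j, hj, h⟩ := h
    exact ⟨j, hj, ih h⟩

theorem exists_right (hA : IsSeparatedSystem E t a A) (hB : IsSeparatedSystem E t b B) (n : ℕ)
    {s : σ} {x : ℝ} (hx : x ∈ A s) : ∃ y, SameItinerary E t a b A B n s x y := by
  induction n generalizing s x with
  | zero =>
    obtain ⟨y, hy⟩ := hB.nonempty s
    exact ⟨y, hx, hy⟩
  | succ n ih =>
    obtain ⟨j, hj, h⟩ := (hA.mem_iff s x).1 hx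
    obtain ⟨y, hy⟩ := ih h
    refine ⟨(y + b s j) / 5, j, hj, ?_⟩
    rwa [show 5 * ((y + b s j) / 5) - b s j = y by ring]

/-- While the edges agree, both distances scale by 5. At the first disagreement separation gives `|x
- x'| ≥ 1/5`, while `|y - y'| ≤ 5`; hence the constant 25. The term `(1/5)^n` covers itineraries
that never disagree. -/
theorem dist_le (hA : IsSeparatedSystem E t a A) (hB : IsSeparatedSystem E t b B) {n : ℕ} {s : σ}
    {x y x' y' : ℝ} (h : SameItinerary E t a b A B n s x y)
    (h' : SameItinerary E t a b A B n s x' y') :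
    dist y y' ≤ 25 * max (dist x x') ((1 / 5) ^ n) := by
  have diam : ∀ {s : σ} {y y' : ℝ}, y ∈ B s → y' ∈ B s → |y - y'| ≤ 5 := by
    intro s y y' hy hy'
    have := hB.subset_Icc s hy
    have := hB.subset_Icc s hy'
    simp only [Set.mem_Icc] at *
    exact abs_le.2 ⟨by linarith, by linarith⟩
  simp only [Real.dist_eq]
  induction n generalizing s x y x' y' with
  | zero =>
    have := diam h.2 h'.2
    have := le_max_right |x - x'| ((1 / 5 : ℝ) ^ 0)
    rw [pow_zero] at this ⊢
    linarith
  | succ n ih =>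
    have hd := diam (h.swap.left_mem hB) (h'.swap.left_mem hB)
    obtain ⟨j, hj, h⟩ := h
    obtain ⟨k, hk, h'⟩ := h'
    by_cases hjk : j = k
    · subst hjk
      have := ih h h'
      rw [show 5 * y - b s j - (5 * y' - b s j) = 5 * (y - y') by ring,
        show 5 * x - a s j - (5 * x' - a s j) = 5 * (x - x') by ring, abs_mul, abs_mul,
        abs_of_pos (by norm_num : (0 : ℝ) < 5),
        show (1 / 5 : ℝ) ^ n = 5 * (1 / 5) ^ (n + 1) by rw [pow_succ]; ring,
        ← mul_max_of_nonneg _ _ (by norm_num : (0 : ℝ) ≤ 5)] at this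
      linarith
    · have := hA.separated s j hj k hk hjk _ _ (h.left_mem hA) (h'.left_mem hA)
      rw [← mul_sub, abs_mul, abs_of_pos (by norm_num : (0 : ℝ) < 5)] at this
      have := le_max_left |x - x'| ((1 / 5) ^ (n + 1))
      linarith

end SameItinerary

/-- Separated solutions of graph-directed systems on the same graph are Lipschitz equivalent. -/
theorem IsSeparatedSystem.lipschitzEquivalent {σ ι : Type*} {E : σ → Set ι} {t : σ → ι → σ}
    {a b : σ → ι → ℝ} {A B : σ → Set ℝ} (hA : IsSeparatedSystem E t a A)
    (hB : IsSeparatedSystem E t b B) (s : σ) : LipschitzEquivalent (A s) (B s) :=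
  lipschitzEquivalent_of_approx (R := fun n => SameItinerary E t a b A B n s)
    (hA.isCompact s).isComplete (hB.isCompact s).isComplete
    (fun _ _ _ h => h.of_succ hA hB)
    (fun _ _ _ h => h.left_mem hA) (fun _ _ _ h => h.swap.left_mem hB)
    (fun n _ hx => SameItinerary.exists_right hA hB n hx)
    (fun n _ hy => (SameItinerary.exists_right hB hA n hy).imp fun _ h => h.swap)
    (by norm_num : (0 : ℝ) < 25)
    (tendsto_pow_atTop_nhds_zero_of_lt_one (by norm_num) (by norm_num))
    (fun _ _ _ _ _ h h' => h.dist_le hA hB h')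
    (fun _ _ _ _ _ h h' => h.swap.dist_le hB hA h'.swap)

/-! ### The two attractors and their translates -/

theorem IsAttractor.mem_fifthMap_iff {I : Finset ℕ} {K : Set ℝ} (hK : IsAttractor fifthMap I K)
    (x : ℝ) : x ∈ K ↔ ∃ i ∈ I, 5 * x - ((i : ℝ) - 1) ∈ K := by
  conv_lhs => rw [← hK.2.2]
  simp only [Set.mem_iUnion, Set.mem_image, exists_prop, fifthMap]
  refine exists_congr fun i => and_congr_right fun _ => ⟨?_, fun h => ⟨_, h, by ring⟩⟩
  rintro ⟨y, hy, rfl⟩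
  rwa [show 5 * (y / 5 + ((i : ℝ) - 1) / 5) - ((i : ℝ) - 1) = y by ring]

/-- The preimages of the minimum `l` and the maximum `u` lie in `K`, so `4 * l ≥ i - 1 ≥ 0` and `4 *
u ≤ k - 1 ≤ 4`. -/
theorem IsAttractor.fifthMap_subset_Icc {I : Finset ℕ} (hI : I ⊆ Finset.Icc 1 5) {K : Set ℝ}
    (hK : IsAttractor fifthMap I K) : K ⊆ Set.Icc 0 1 := by
  have hI' : ∀ i ∈ I, (1 : ℝ) ≤ i ∧ (i : ℝ) ≤ 5 := fun i hi => by
    have := Finset.mem_Icc.1 (hI hi)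
    exact_mod_cast this
  obtain ⟨l, hl, hl'⟩ := hK.2.1.exists_isLeast hK.1
  obtain ⟨u, hu, hu'⟩ := hK.2.1.exists_isGreatest hK.1
  intro x hx
  obtain ⟨i, hi, h⟩ := (hK.mem_fifthMap_iff l).1 hl
  obtain ⟨k, hk, h'⟩ := (hK.mem_fifthMap_iff u).1 hu
  have := hI' i hi
  have := hI' k hk
  have := hl' h
  have := hu' h'
  have := hl' hx
  have := hu' hx
  constructor <;> linarith

/-- The union of the translates of `K` by `0, d, …, s d`. -/
def translates (d : ℝ) (K : Set ℝ) (s : Fin 3) : Set ℝ :=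
  {x | ∃ i : Fin 3, i ≤ s ∧ x - d * (i : ℕ) ∈ K}

theorem isCompact_translates (d : ℝ) {K : Set ℝ} (hK : IsCompact K) (s : Fin 3) :
    IsCompact (translates d K s) := by
  have : translates d K s = ⋃ i ∈ {i : Fin 3 | i ≤ s}, (fun x => x + d * (i : ℕ)) '' K := by
    ext x
    simp [translates, sub_eq_add_neg]
  rw [this]
  exact (Set.toFinite _).isCompact_biUnion fun i _ => hK.image (by fun_prop)

/-- The `s + 2` edges that leave the vertex `s`. -/
def edges (s : Fin 3) : Set (Fin 4) := {j | (j : ℕ) ≤ s + 1}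

/-- The end of the edge `j` that leaves the vertex `s`. -/
def target (s : Fin 3) (j : Fin 4) : Fin 3 :=
  if j = 0 then 0 else if (j : ℕ) = s + 1 then 1 else 2

/-- The translations in the decomposition of unions of consecutive `{1,4,5}`-sets. -/
def touchingShift (_ : Fin 3) (j : Fin 4) : ℝ := if j = 0 then 0 else 5 * (j : ℕ) - 2

/-- The translations in the decomposition of unions of neighbouring `{1,3,5}`-sets. -/
def dustShift (s : Fin 3) (j : Fin 4) : ℝ :=
  if j = 0 then 0 else if (j : ℕ) = s + 1 then 2 else 10 * (j : ℕ)

theorem translates_zero (d : ℝ) (K : Set ℝ) : translates d K 0 = K := by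
  ext x
  simp [translates]

theorem mem_translates_one {d : ℝ} {K : Set ℝ} {x : ℝ} :
    x ∈ translates d K 1 ↔ x ∈ K ∨ x - d ∈ K := by
  simp [translates, Fin.exists_fin_succ]

theorem mem_translates_two {d : ℝ} {K : Set ℝ} {x : ℝ} :
    x ∈ translates d K 2 ↔ x ∈ K ∨ x - d ∈ K ∨ x - d * 2 ∈ K := by
  simp [translates, Fin.exists_fin_succ, Fin.le_def, one_add_one_eq_two]

theorem translates_subset_Icc {d : ℝ} (hd : 0 ≤ d) {K : Set ℝ} (hK : K ⊆ Set.Icc 0 1) (s : Fin 3) :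
    translates d K s ⊆ Set.Icc 0 (d * (s : ℕ) + 1) := by
  rintro x ⟨i, hi, hx⟩
  have hx := hK hx
  have h : d * (i : ℕ) ≤ d * (s : ℕ) :=
    mul_le_mul_of_nonneg_left (by exact_mod_cast Fin.le_def.1 hi) hd
  have : 0 ≤ d * (i : ℕ) := by positivity
  constructor <;> linarith [hx.1, hx.2]

/-- Scaled by 5, the pieces start at `5i + {0, 3, 4}` for `i ≤ s`. The last two of each block touch
the first of the next, giving runs `{0}`, `{3, 4, 5}`, `{8, 9, 10}`, … and a final pair. -/
theorem isSeparatedSystem_translates_one {K : Set ℝ} (hK : IsAttractor fifthMap {1, 4, 5} K) :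
    IsSeparatedSystem edges target touchingShift (translates 1 K) where
  nonempty s := hK.1.imp fun x hx => ⟨0, Fin.zero_le _, by simpa using hx⟩
  isCompact := isCompact_translates 1 hK.2.1
  subset_Icc s x hx := by
    have h := translates_subset_Icc (by norm_num) (hK.fifthMap_subset_Icc (by decide)) s hx
    have : ((s : ℕ) : ℝ) ≤ 2 := by exact_mod_cast (by omega : (s : ℕ) ≤ 2)
    exact ⟨h.1, h.2.trans (by linarith)⟩
  mem_iff s x := by
    have key : ∀ x, x ∈ K ↔ 5 * x ∈ K ∨ 5 * x - 3 ∈ K ∨ 5 * x - 4 ∈ K := fun x => by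
      rw [hK.mem_fifthMap_iff]
      norm_num
    fin_cases s <;>
      simp [Fin.exists_fin_succ, edges, target, touchingShift, mem_translates_one,
        mem_translates_two, translates_zero, key x, key (x - _)] <;>
      ring_nf <;> tauto
  separated s j hj k hk hjk x y hx hy := by
    have hx := translates_subset_Icc (by norm_num) (hK.fifthMap_subset_Icc (by decide)) _ hx
    have hy := translates_subset_Icc (by norm_num) (hK.fifthMap_subset_Icc (by decide)) _ hy
    rw [le_abs]
    fin_cases s <;> fin_cases j <;> fin_cases k <;>
      simp [edges, target, touchingShift] at hj hk hjk hx hy ⊢ <;>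
      first | (left; linarith) | (right; linarith)

/-- Scaled by 5, the pieces start at `10i + {0, 2, 4}` for `i ≤ s`. Each block with `i ≥ 1` is a
whole `A 2`; the block `i = 0` is split as `{0}` and `{2, 4}` to match the graph. -/
theorem isSeparatedSystem_translates_two {K : Set ℝ} (hK : IsAttractor fifthMap {1, 3, 5} K) :
    IsSeparatedSystem edges target dustShift (translates 2 K) where
  nonempty s := hK.1.imp fun x hx => ⟨0, Fin.zero_le _, by simpa using hx⟩
  isCompact := isCompact_translates 2 hK.2.1
  subset_Icc s x hx := by
    have h := translates_subset_Icc (by norm_num) (hK.fifthMap_subset_Icc (by decide)) s hx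
    have : ((s : ℕ) : ℝ) ≤ 2 := by exact_mod_cast (by omega : (s : ℕ) ≤ 2)
    exact ⟨h.1, h.2.trans (by linarith)⟩
  mem_iff s x := by
    have key : ∀ x, x ∈ K ↔ 5 * x ∈ K ∨ 5 * x - 2 ∈ K ∨ 5 * x - 4 ∈ K := fun x => by
      rw [hK.mem_fifthMap_iff]
      norm_num
    fin_cases s <;>
      simp [Fin.exists_fin_succ, edges, target, dustShift, mem_translates_one,
        mem_translates_two, translates_zero, key x, key (x - _)] <;>
      ring_nf <;> tauto
  separated s j hj k hk hjk x y hx hy := by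
    have hx := translates_subset_Icc (by norm_num) (hK.fifthMap_subset_Icc (by decide)) _ hx
    have hy := translates_subset_Icc (by norm_num) (hK.fifthMap_subset_Icc (by decide)) _ hy
    rw [le_abs]
    fin_cases s <;> fin_cases j <;> fin_cases k <;>
      simp [edges, target, dustShift] at hj hk hjk hx hy ⊢ <;>
      first | (left; linarith) | (right; linarith)

/-- The `{1,3,5}`-set `M` and the `{1,4,5}`-set `M'` are Lipschitz equivalent. -/
theorem mainTheorem7 (M M' : Set ℝ)
    (hM : IsAttractor fifthMap {1, 3, 5} M) (hM' : IsAttractor fifthMap {1, 4, 5} M') :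
    LipschitzEquivalent M M' := by
  simpa only [translates_zero] using
    (isSeparatedSystem_translates_two hM).lipschitzEquivalent
      (isSeparatedSystem_translates_one hM') 0
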